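/- Theorem (maximum leave-one-out effect differences model). Let $Z=(X,A,Y)\sim\mathcal P$ with $X\in\mathbb R^d$, $A\in\{0,1\}$, $Y\in\mathbb R$, $\mathbb E|Y|<\infty$. For $j\in[d]$ let $X_{-j}$ be $X$ without its $j$th coordinate and put $X_{-\emptyset}=X$. For $j\in[d]\cup\{\emptyset\}$ let $\pi_a(X_{-j})=\mathbb P(A=a\mid X_{-j})$, $\mu_a(X_{-j})=\mathbb E(Y\mid A=a,X_{-j})$, $\psi_{-j}=\mathbb E\{\mu_1(X_{-j})-\mu_0(X_{-j})\}$ and $$\phi(Z_{-j})=\mu_1(X_{-j})-\mu_0(X_{-j})+\Big\{\tfrac{A}{\pi_1(X_{-j})}-\tfrac{1-A}{\pi_0(X_{-j})}\Big\}\{Y-\mu_A(X_{-j})\};$$ write $\psi=\psi_{-\emptyset}$ and $\phi(Z)=\phi(Z_{-\emptyset})$. For $\Gamma\in(0,\infty)$ let $$\mathcal U(\Gamma)=\psi+\Gamma\max_{j\in[d]}|\psi-\psi_{-j}|,\qquad \widehat{\mathcal U}(\Gamma)=\mathbb P_n\{\widehat\phi(Z)\}+\Gamma\max_{j\in[d]}\big|\mathbb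 P_n\{\widehat\phi(Z)-\widehat\phi(Z_{-j})\}\big|,$$ where $\mathbb P_n$ is the average over i.i.d. observations $Z_1,\dots,Z_n\sim\mathcal P$, and $\widehat\phi(Z_{-j})$ is $\phi(Z_{-j})$ with $\pi_1,\pi_0,\mu_a$ replaced by estimates $\widehat\pi_1,\ \widehat\pi_0=1-\widehat\pi_1,\ \widehat\mu_a$ constructed from training data (which may depend on $n$) independent of $Z_1,\dots,Z_n$. For a possibly random function $f$, $\|f(Z)\|_2=(\int f(z)^2\,d\mathcal P(z))^{1/2}$, with the training data held fixed. Assume: - (positivity) there is $\varepsilon>0$ with $\mathbb P\{\varepsilon\le\pi_1(X)\le1-\varepsilon\}=1$; - (bounded and nonzero measured confounding) $|\psi-\psi_{-j}|<\infty$ for all $j\in[d]$, and $|\psi-\psi_{-j}|>0$ for some $j\in[d]$; - (separation) there is $j'\in[d]$ with $|\psi-\psi_{-j'}|>|\psi-\psi_{-j}|$ for all $j\in[d]\setminus\{j'\}$; 1. there is a constant $c>0$ such that for each $j\in[d]\cup\{\emptyset\}$ and all sufficiently large $n$, almost surely $c\le\widehat\pi_1(X_{-j})\le1-c$; 2. for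 each $j\in[d]\cup\{\emptyset\}$, $\|\widehat\phi(Z_{-j})-\phi(Z_{-j})\|_2\to0$ in probability; 3. for $j\in\{j',\emptyset\}$, $\|\widehat\pi_1(X_{-j})-\pi_1(X_{-j})\|_2\sum_{a\in\{0,1\}}\|\widehat\mu_a(X_{-j})-\mu_a(X_{-j})\|_2=o_{\mathbb P}(n^{-1/2})$. Then $\phi(Z)+\operatorname{sign}(\psi-\psi_{-j'})\,\Gamma\{\phi(Z)-\phi(Z_{-j'})\}$ is integrable and $$\widehat{\mathcal U}(\Gamma)-\mathcal U(\Gamma)=(\mathbb P_n-\mathbb E)\Big[\phi(Z)+\operatorname{sign}(\psi-\psi_{-j'})\,\Gamma\big\{\phi(Z)-\phi(Z_{-j'})\big\}\Big]+o_{\mathbb P}(n^{-1/2}).$$ -/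

import Mathlib

open MeasureTheory ProbabilityTheory Filter Topology
open scoped ENNReal

noncomputable section

namespace EffectDifferences

/-- An observation `Z = (X, A, Y)`: covariates `X ∈ ℝᵈ`, binary exposure `A ∈ {0, 1}`,
outcome `Y ∈ ℝ`. -/
abbrev Obs (d : ℕ) : Type := (Fin d → ℝ) × Fin 2 × ℝ

/-- The covariates that remain when `o` is left out: all of them for `o = none`
(written `∅` on paper), all but the `j`-th for `o = some j`. -/
abbrev Kept (d : ℕ) (o : Option (Fin d)) : Type := {i : Fin d // o ≠ some i}

/-- The space of values of `X₋ⱼ`. -/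
abbrev Cov (d : ℕ) (o : Option (Fin d)) : Type := Kept d o → ℝ

variable {d : ℕ}

/-- The covariate vector `X₋ⱼ` of an observation. -/
def cov (o : Option (Fin d)) (z : Obs d) : Cov d o := fun i => z.1 i.1

/-- The exposure `A` of an observation. -/
def trt (z : Obs d) : Fin 2 := z.2.1

/-- The outcome `Y` of an observation. -/
def out (z : Obs d) : ℝ := z.2.2

/-- The propensity score `π₁(x) = P(A = 1 ∣ X₋ⱼ = x)`, from the regular conditional
distribution of `A` given `X₋ⱼ`. -/
def propensity (P : Measure (Obs d)) [IsFiniteMeasure P] (o : Option (Fin d))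
    (x : Cov d o) : ℝ :=
  (condDistrib (trt (d := d)) (cov o) P x).real {1}

/-- The outcome regression `μₐ(x) = E(Y ∣ A = a, X₋ⱼ = x)`, the mean of the regular conditional
distribution of `Y` given `(A, X₋ⱼ)`. -/
def outcomeReg (P : Measure (Obs d)) [IsFiniteMeasure P] (o : Option (Fin d))
    (a : Fin 2) (x : Cov d o) : ℝ :=
  ∫ y, y ∂(condDistrib (out (d := d)) (fun z => (trt z, cov o z)) P (a, x))

/-- The adjusted mean difference `ψ₋ⱼ = E{μ₁(X₋ⱼ) - μ₀(X₋ⱼ)}`; `ψ` is the case `o = none`. -/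
def adjDiff (P : Measure (Obs d)) [IsFiniteMeasure P] (o : Option (Fin d)) : ℝ :=
  ∫ z, (outcomeReg P o 1 (cov o z) - outcomeReg P o 0 (cov o z)) ∂P

/-- The doubly robust (AIPW) function built from a propensity function `p` (for exposure `1`; the
one for exposure `0` is `1 - p`) and outcome functions `m a`:
`m₁(X₋ⱼ) - m₀(X₋ⱼ) + {A / p(X₋ⱼ) - (1 - A) / (1 - p(X₋ⱼ))} {Y - m_A(X₋ⱼ)}`. -/
def aipw (o : Option (Fin d)) (p : Cov d o → ℝ) (m : Fin 2 → Cov d o → ℝ) (z : Obs d) : ℝ :=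
  m 1 (cov o z) - m 0 (cov o z)
    + (((trt z : ℕ) : ℝ) / p (cov o z) - (1 - ((trt z : ℕ) : ℝ)) / (1 - p (cov o z)))
      * (out z - m (trt z) (cov o z))

/-- The efficient influence function `φ(Z₋ⱼ)`: the AIPW function at the true nuisance functions. -/
def eif (P : Measure (Obs d)) [IsFiniteMeasure P] (o : Option (Fin d)) (z : Obs d) : ℝ :=
  aipw o (propensity P o) (outcomeReg P o) z

/-- The upper bound `𝒰(Γ) = ψ + Γ maxⱼ |ψ - ψ₋ⱼ|` (the supremum is over a finite set). -/
def upperBound (P : Measure (Obs d)) [IsFiniteMeasure P] (Γ : ℝ) : ℝ :=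
  adjDiff P none + Γ * ⨆ j : Fin d, |adjDiff P none - adjDiff P (some j)|

/-- The sample average `ℙₙ f` over the sample points `z 0, …, z (n - 1)`. -/
def empMean (n : ℕ) (z : ℕ → Obs d) (f : Obs d → ℝ) : ℝ :=
  (n : ℝ)⁻¹ * ∑ i ∈ Finset.range n, f (z i)

/-- The estimator `ℙₙ φ̂(Z) + Γ maxⱼ |ℙₙ {φ̂(Z) - φ̂(Z₋ⱼ)}|`, for given functions `φ̂(Z₋ⱼ)`. -/
def upperEst (Γ : ℝ) (n : ℕ) (z : ℕ → Obs d) (phi : Option (Fin d) → Obs d → ℝ) : ℝ :=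
  empMean n z (phi none)
    + Γ * ⨆ j : Fin d, |empMean n z (fun w => phi none w - phi (some j) w)|

/-- `Rₙ = o_ℙ(rₙ)` for nonnegative, possibly infinite random quantities `Rₙ`:
`ℙ(Rₙ > ε rₙ) → 0` for every `ε > 0`. -/
def IsLittleOProb {Ω : Type*} [MeasurableSpace Ω] (μ : Measure Ω)
    (R : ℕ → Ω → ℝ≥0∞) (r : ℕ → ℝ) : Prop :=
  ∀ ε : ℝ, 0 < ε → Tendsto (fun n => μ {ω | ENNReal.ofReal (ε * r n) < R n ω}) atTop (𝓝 0)

end EffectDifferences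

end

open EffectDifferences

namespace EffectDifferences

section Nuisance

variable {d : ℕ}

/-! ### Measurability -/

/-! The maximum of `|ψ - ψ₋ⱼ|` is attained at `j'` alone and is nonzero, so the map sending a vector
to its largest absolute entry is exactly affine near the true vector, with slope the sign of the
`j'` entry in that direction and zero in all others (`exists_iSup_abs_sub_eq`). Mere consistency of
every estimated coordinate puts the sample vector in that neighbourhood with probability tending to
one (`isLittleOProb_empMean_aipw_sub_adjDiff`). On that event the error of the upper bound is an
affine combination of two doubly robust estimators, for the full covariates and for those without
`j'`, which is why a rate is needed for these two only.

Each of the two satisfies `ℙₙ φ̂ - ℙₙ φ = (ℙₙ - P)(φ̂ - φ) + P(φ̂ - φ)`. The first term is small by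
Chebyshev conditionally on the training data (`measure_empMean_training_le`). The second is bounded
by a product of nuisance errors (`enorm_integral_aipw_sub_eif_le`), because residuals of the true
regression have mean zero under any weight in `(A, X₋ⱼ)` that is bounded. Only `φ̂ - φ` has to be
close in `L₂`; for `φ` itself integrability and the law of large numbers suffice, so no second
moment of `Y` enters. -/

theorem measurable_cov (o : Option (Fin d)) : Measurable (cov (d := d) o) :=
  measurable_pi_lambda _ fun i => (measurable_pi_apply i.1).comp measurable_fst

theorem measurable_trt : Measurable (trt (d := d)) := measurable_fst.comp measurable_snd

theorem measurable_out : Measurable (out (d := d)) := measurable_snd.comp measurable_snd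

theorem measurable_trt_real : Measurable fun z : Obs d => ((trt z : ℕ) : ℝ) :=
  (measurable_of_countable fun a : Fin 2 => ((a : ℕ) : ℝ)).comp measurable_trt

/-- The signed inverse probability weight `A / p(X₋ⱼ) - (1 - A) / (1 - p(X₋ⱼ))`. -/
noncomputable def ipw (o : Option (Fin d)) (p : Cov d o → ℝ) (z : Obs d) : ℝ :=
  ((trt z : ℕ) : ℝ) / p (cov o z) - (1 - ((trt z : ℕ) : ℝ)) / (1 - p (cov o z))

theorem aipw_eq (o : Option (Fin d)) (p : Cov d o → ℝ) (m : Fin 2 → Cov d o → ℝ) (z : Obs d) :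
    aipw o p m z = m 1 (cov o z) - m 0 (cov o z)
      + ipw o p z * (out z - m (trt z) (cov o z)) := rfl

/-- Being affine in the exposure turns measurability of evaluation at a random arm into
measurability of sums and products. -/
theorem apply_trt_eq {α : Type*} (f : Fin 2 → α → ℝ) (a : Fin 2) (x : α) :
    f a x = ((a : ℕ) : ℝ) * f 1 x + (1 - ((a : ℕ) : ℝ)) * f 0 x := by
  fin_cases a <;> simp

theorem measurable_apply_trt {S : Type*} [MeasurableSpace S] (o : Option (Fin d))
    {m : S → Fin 2 → Cov d o → ℝ}
    (hm : ∀ a, Measurable fun q : S × Cov d o => m q.1 a q.2) :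
    Measurable fun q : S × Obs d => m q.1 (trt q.2) (cov o q.2) := by
  have hc : Measurable fun q : S × Obs d => (q.1, cov o q.2) :=
    measurable_fst.prodMk ((measurable_cov o).comp measurable_snd)
  have ht : Measurable fun q : S × Obs d => ((trt q.2 : ℕ) : ℝ) :=
    measurable_trt_real.comp measurable_snd
  simp_rw [fun q : S × Obs d => apply_trt_eq (m q.1) (trt q.2) (cov o q.2)]
  exact (ht.mul ((hm 1).comp hc)).add ((measurable_const.sub ht).mul ((hm 0).comp hc))

theorem measurable_ipw {S : Type*} [MeasurableSpace S] (o : Option (Fin d))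
    {p : S → Cov d o → ℝ} (hp : Measurable fun q : S × Cov d o => p q.1 q.2) :
    Measurable fun q : S × Obs d => ipw o (p q.1) q.2 := by
  have hc : Measurable fun q : S × Obs d => (q.1, cov o q.2) :=
    measurable_fst.prodMk ((measurable_cov o).comp measurable_snd)
  have ht : Measurable fun q : S × Obs d => ((trt q.2 : ℕ) : ℝ) :=
    measurable_trt_real.comp measurable_snd
  exact (ht.div (hp.comp hc)).sub
    ((measurable_const.sub ht).div (measurable_const.sub (hp.comp hc)))

theorem measurable_aipw {S : Type*} [MeasurableSpace S] (o : Option (Fin d))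
    {p : S → Cov d o → ℝ} {m : S → Fin 2 → Cov d o → ℝ}
    (hp : Measurable fun q : S × Cov d o => p q.1 q.2)
    (hm : ∀ a, Measurable fun q : S × Cov d o => m q.1 a q.2) :
    Measurable fun q : S × Obs d => aipw o (p q.1) (m q.1) q.2 := by
  have hc : Measurable fun q : S × Obs d => (q.1, cov o q.2) :=
    measurable_fst.prodMk ((measurable_cov o).comp measurable_snd)
  exact (((hm 1).comp hc).sub ((hm 0).comp hc)).add
    ((measurable_ipw o hp).mul
      ((measurable_out.comp measurable_snd).sub (measurable_apply_trt o hm)))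

variable (P : Measure (Obs d)) [IsProbabilityMeasure P]

theorem measurable_propensity (o : Option (Fin d)) : Measurable (propensity P o) :=
  (Kernel.measurable_coe _ (measurableSet_singleton 1)).ennreal_toReal

theorem measurable_outcomeReg_prod (o : Option (Fin d)) :
    Measurable fun q : Fin 2 × Cov d o => outcomeReg P o q.1 q.2 :=
  (measurable_id.stronglyMeasurable.integral_kernel
    (κ := condDistrib (out (d := d)) (fun z => (trt z, cov o z)) P)).measurable

theorem measurable_outcomeReg (o : Option (Fin d)) (a : Fin 2) :
    Measurable (outcomeReg P o a) :=
  (measurable_outcomeReg_prod P o).comp measurable_prodMk_left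

theorem measurable_eif (o : Option (Fin d)) : Measurable (eif P o) :=
  (measurable_aipw (S := Unit) o (p := fun _ => propensity P o) (m := fun _ => outcomeReg P o)
    ((measurable_propensity P o).comp measurable_snd)
    fun a => (measurable_outcomeReg P o a).comp measurable_snd).comp
      (measurable_prodMk_left (x := ()))

/-! ### Averaging over the exposure -/

theorem condDistrib_trt_one (o : Option (Fin d)) (x : Cov d o) :
    condDistrib (trt (d := d)) (cov o) P x {1} = ENNReal.ofReal (propensity P o x) :=
  (ofReal_measureReal).symm

theorem condDistrib_trt_real_zero (o : Option (Fin d)) (x : Cov d o) :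
    (condDistrib (trt (d := d)) (cov o) P x).real {0} = 1 - propensity P o x := by
  have h := probReal_compl_eq_one_sub (μ := condDistrib (trt (d := d)) (cov o) P x)
    (measurableSet_singleton (1 : Fin 2))
  have h2 : ({1}ᶜ : Set (Fin 2)) = {0} := by
    ext a; fin_cases a <;> simp
  rw [h2] at h
  exact h

theorem condDistrib_trt_zero (o : Option (Fin d)) (x : Cov d o) :
    condDistrib (trt (d := d)) (cov o) P x {0} = ENNReal.ofReal (1 - propensity P o x) := by
  rw [← condDistrib_trt_real_zero, ofReal_measureReal]

/-- Disintegrate the joint law of covariates and exposure along the covariates; the fibre is a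
two-point law with weights `1 - π₁` and `π₁`. This version serves to prove integrability, the
Bochner version below to compute means. -/
theorem lintegral_cov_trt (o : Option (Fin d)) {f : Cov d o × Fin 2 → ℝ≥0∞}
    (hf : Measurable f) :
    ∫⁻ z, f (cov o z, trt z) ∂P =
      ∫⁻ z, (f (cov o z, 0) * ENNReal.ofReal (1 - propensity P o (cov o z))
        + f (cov o z, 1) * ENNReal.ofReal (propensity P o (cov o z))) ∂P := by
  have h1 : Measurable fun z : Obs d => (cov o z, trt z) :=
    (measurable_cov o).prodMk measurable_trt
  rw [← lintegral_map hf h1, ← compProd_map_condDistrib measurable_trt.aemeasurable,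
    Measure.lintegral_compProd hf]
  simp_rw [lintegral_fintype, Fin.sum_univ_two, condDistrib_trt_one, condDistrib_trt_zero]
  have hp := measurable_propensity P o
  rw [lintegral_map _ (measurable_cov o)]
  fun_prop

theorem integral_cov_trt (o : Option (Fin d)) {f : Cov d o × Fin 2 → ℝ}
    (hf : Measurable f) (hfi : Integrable (fun z => f (cov o z, trt z)) P) :
    ∫ z, f (cov o z, trt z) ∂P =
      ∫ z, ((1 - propensity P o (cov o z)) * f (cov o z, 0)
        + propensity P o (cov o z) * f (cov o z, 1)) ∂P := by
  have h1 : Measurable fun z : Obs d => (cov o z, trt z) :=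
    (measurable_cov o).prodMk measurable_trt
  have hi : Integrable f (P.map fun z => (cov o z, trt z)) :=
    (integrable_map_measure hf.aestronglyMeasurable h1.aemeasurable).2 hfi
  have h2 : ∀ x, ∫ a, f (x, a) ∂(condDistrib (trt (d := d)) (cov o) P x)
      = (1 - propensity P o x) * f (x, 0) + propensity P o x * f (x, 1) := fun x => by
    rw [integral_fintype Integrable.of_finite, Fin.sum_univ_two, condDistrib_trt_real_zero]
    rfl
  rw [← integral_map h1.aemeasurable hf.aestronglyMeasurable,
    ← compProd_map_condDistrib measurable_trt.aemeasurable]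
  rw [← compProd_map_condDistrib measurable_trt.aemeasurable] at hi
  rw [Measure.integral_compProd hi]
  simp_rw [h2]
  have hp := measurable_propensity P o
  rw [integral_map (measurable_cov o).aemeasurable]
  exact Measurable.aestronglyMeasurable (by fun_prop)

/-- Positivity for the full covariate vector passes to every covariate subset. -/
theorem propensity_bounds_of_none {ε : ℝ}
    (hpos : ∀ᵐ z ∂P, ε ≤ propensity P none (cov none z)
      ∧ propensity P none (cov none z) ≤ 1 - ε) (o : Option (Fin d)) :
    ∀ᵐ z ∂P, ε ≤ propensity P o (cov o z) ∧ propensity P o (cov o z) ≤ 1 - ε := by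
  -- The kept covariates are a function of all covariates, so the tower property makes the coarser
  -- propensity a conditional mean of the finer one, and conditional means preserve constant bounds.
  have hle : MeasurableSpace.comap (cov o) inferInstance
      ≤ MeasurableSpace.comap (cov (d := d) none) inferInstance := by
    have : cov (d := d) o = (fun x i => x ⟨i.1, by simp⟩) ∘ cov none := rfl
    rw [this, ← MeasurableSpace.comap_comp]
    exact MeasurableSpace.comap_mono (Measurable.comap_le (by fun_prop))
  have hle' := (measurable_cov (d := d) none).comap_le
  have h1 := condDistrib_ae_eq_condExp (μ := P) (measurable_cov (d := d) none) measurable_trt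
    (measurableSet_singleton (1 : Fin 2))
  have h2 := condDistrib_ae_eq_condExp (μ := P) (measurable_cov (d := d) o) measurable_trt
    (measurableSet_singleton (1 : Fin 2))
  have h3 := condExp_condExp_of_le (μ := P) (f := (trt (d := d) ⁻¹' {1}).indicator fun _ => (1 : ℝ))
    hle hle'
  have h4 := condExp_congr_ae (m := MeasurableSpace.comap (cov o) inferInstance) h1
  have hint : Integrable (fun z => propensity P none (cov none z)) P :=
    integrable_condExp.congr h1.symm
  have h5 := condExp_mono (m := MeasurableSpace.comap (cov (d := d) o) inferInstance)
    (integrable_const ε) hint (hpos.mono fun z hz => hz.1)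
  have h6 := condExp_mono (m := MeasurableSpace.comap (cov (d := d) o) inferInstance)
    hint (integrable_const (1 - ε)) (hpos.mono fun z hz => hz.2)
  rw [condExp_const (measurable_cov o).comap_le] at h5 h6
  filter_upwards [h2, h3, h4, h5, h6] with z g2 g3 g4 g5 g6
  have : propensity P o (cov o z)
      = (P[fun z => propensity P none (cov none z)
          | MeasurableSpace.comap (cov o) inferInstance]) z :=
    g2.trans (g3.symm.trans g4.symm)
  rw [this]
  exact ⟨g5, g6⟩

/-! ### The outcome regression -/

theorem condExp_out (hY : Integrable (out (d := d)) P) (o : Option (Fin d)) :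
    P[out (d := d) | MeasurableSpace.comap (fun z => (trt z, cov o z)) inferInstance]
      =ᵐ[P] fun z => outcomeReg P o (trt z) (cov o z) :=
  condExp_ae_eq_integral_condDistrib' (measurable_trt.prodMk (measurable_cov o)) hY

theorem integrable_outcomeReg_trt (hY : Integrable (out (d := d)) P) (o : Option (Fin d)) :
    Integrable (fun z => outcomeReg P o (trt z) (cov o z)) P :=
  integrable_condExp.congr (condExp_out P hY o)

/-- Integrability of `Y` controls the regression only at the arm actually received. Averaging over
the exposure gives each arm a weight of at least `ε`, so positivity transfers the control to both
arms. -/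
theorem integrable_outcomeReg (hY : Integrable (out (d := d)) P) (o : Option (Fin d)) {ε : ℝ}
    (hε : 0 < ε) (hpos : ∀ᵐ z ∂P, ε ≤ propensity P o (cov o z)
      ∧ propensity P o (cov o z) ≤ 1 - ε) (a : Fin 2) :
    Integrable (fun z => outcomeReg P o a (cov o z)) P := by
  have hm := measurable_outcomeReg_prod P o
  refine ⟨((measurable_outcomeReg P o a).comp (measurable_cov o)).aestronglyMeasurable, ?_⟩
  have h := (integrable_outcomeReg_trt P hY o).2
  rw [HasFiniteIntegral, lintegral_cov_trt P o
    (f := fun q => ‖outcomeReg P o q.2 q.1‖ₑ) (by fun_prop)] at h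
  have h2 : ∫⁻ z, ENNReal.ofReal ε * ‖outcomeReg P o a (cov o z)‖ₑ ∂P < ∞ := by
    refine lt_of_le_of_lt (lintegral_mono_ae ?_) h
    filter_upwards [hpos] with z hz
    fin_cases a
    · refine le_trans ?_ le_self_add
      rw [mul_comm]
      exact mul_le_mul_right (ENNReal.ofReal_le_ofReal (by linarith [hz.2])) _
    · refine le_trans ?_ le_add_self
      rw [mul_comm]
      exact mul_le_mul_right (ENNReal.ofReal_le_ofReal hz.1) _
  rw [lintegral_const_mul' _ _ ENNReal.ofReal_ne_top] at h2
  refine lt_of_mul_lt_mul_left' (a := ENNReal.ofReal ε) (h2.trans_le ?_)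
  rw [ENNReal.mul_top (by simpa using hε)]

theorem abs_ipw_le {o : Option (Fin d)} {p : Cov d o → ℝ} {z : Obs d} {c : ℝ} (hc : 0 < c)
    (hp : c ≤ p (cov o z) ∧ p (cov o z) ≤ 1 - c) : |ipw o p z| ≤ c⁻¹ := by
  have h1 : 0 < p (cov o z) := hc.trans_le hp.1
  have h2 : c ≤ 1 - p (cov o z) := by linarith [hp.2]
  have h3 : 0 < 1 - p (cov o z) := hc.trans_le h2
  unfold ipw
  have : trt z = 0 ∨ trt z = 1 := by
    generalize trt z = a
    fin_cases a <;> simp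
  rcases this with h | h
  · simp only [h, Fin.val_zero, Nat.cast_zero, zero_div, sub_zero, zero_sub, abs_neg, one_div,
      abs_inv, abs_of_pos h3]
    exact inv_anti₀ hc h2
  · simp only [h, Fin.val_one, Nat.cast_one, sub_self, zero_div, sub_zero, one_div, abs_inv,
      abs_of_pos h1]
    exact inv_anti₀ hc hp.1

variable {P} in
/-- Weighted residuals of the outcome regression have mean zero. -/
theorem integral_ipw_mul_residual (hY : Integrable (out (d := d)) P) (o : Option (Fin d))
    {p : Cov d o → ℝ} (hp : Measurable p) {c : ℝ} (hc : 0 < c)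
    (hpc : ∀ᵐ z ∂P, c ≤ p (cov o z) ∧ p (cov o z) ≤ 1 - c) :
    Integrable (fun z => ipw o p z * (out z - outcomeReg P o (trt z) (cov o z))) P ∧
      ∫ z, ipw o p z * (out z - outcomeReg P o (trt z) (cov o z)) ∂P = 0 := by
  have hg : Measurable fun z : Obs d => (trt z, cov o z) :=
    measurable_trt.prodMk (measurable_cov o)
  have hw : Measurable (ipw o p) :=
    (measurable_trt_real.div (hp.comp (measurable_cov o))).sub
      ((measurable_const.sub measurable_trt_real).div
        (measurable_const.sub (hp.comp (measurable_cov o))))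
  have hwb : ∀ᵐ z ∂P, ‖ipw o p z‖ ≤ c⁻¹ := hpc.mono fun z hz => abs_ipw_le hc hz
  -- The weight is a function of `(A, X₋ⱼ)`, so it can be pulled out of the conditional expectation
  -- of `Y` given that pair.
  have hwm : StronglyMeasurable[MeasurableSpace.comap (fun z : Obs d => (trt z, cov o z))
      inferInstance] (ipw o p) := by
    have h1 : Measurable fun q : Fin 2 × Cov d o =>
        ((q.1 : ℕ) : ℝ) / p q.2 - (1 - ((q.1 : ℕ) : ℝ)) / (1 - p q.2) := by
      have : Measurable fun q : Fin 2 × Cov d o => ((q.1 : ℕ) : ℝ) :=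
        (measurable_of_countable fun a : Fin 2 => ((a : ℕ) : ℝ)).comp measurable_fst
      fun_prop
    have h2 := h1.comp (comap_measurable fun z : Obs d => (trt z, cov o z))
    exact h2.stronglyMeasurable
  have i1 : Integrable (fun z => ipw o p z * out z) P :=
    hY.bdd_mul hw.aestronglyMeasurable hwb
  have i2 : Integrable (fun z => ipw o p z * outcomeReg P o (trt z) (cov o z)) P :=
    (integrable_outcomeReg_trt P hY o).bdd_mul hw.aestronglyMeasurable hwb
  have h1 := condExp_mul_of_stronglyMeasurable_left hwm i1 hY
  have h2 : ∫ z, ipw o p z * out z ∂P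
      = ∫ z, ipw o p z * outcomeReg P o (trt z) (cov o z) ∂P := by
    rw [← integral_condExp hg.comap_le (f := fun z => ipw o p z * out z)]
    refine integral_congr_ae (h1.trans ?_)
    filter_upwards [condExp_out P hY o] with z hz
    rw [Pi.mul_apply, hz]
  have h3 : (fun z => ipw o p z * (out z - outcomeReg P o (trt z) (cov o z)))
      = fun z => ipw o p z * out z - ipw o p z * outcomeReg P o (trt z) (cov o z) :=
    funext fun z => mul_sub _ _ _
  rw [h3]
  exact ⟨i1.sub i2, by rw [integral_sub i1 i2, h2, sub_self]⟩

variable {P} in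
theorem integrable_eif (hY : Integrable (out (d := d)) P) (o : Option (Fin d)) {ε : ℝ}
    (hε : 0 < ε) (hpos : ∀ᵐ z ∂P, ε ≤ propensity P o (cov o z)
      ∧ propensity P o (cov o z) ≤ 1 - ε) :
    Integrable (eif P o) P :=
  ((integrable_outcomeReg P hY o hε hpos 1).sub (integrable_outcomeReg P hY o hε hpos 0)).add
    (integral_ipw_mul_residual hY o (measurable_propensity P o) hε hpos).1

variable {P} in
-- The correction term is a weighted residual with mean zero, leaving the mean of the regression
-- contrast.
theorem integral_eif (hY : Integrable (out (d := d)) P) (o : Option (Fin d)) {ε : ℝ}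
    (hε : 0 < ε) (hpos : ∀ᵐ z ∂P, ε ≤ propensity P o (cov o z)
      ∧ propensity P o (cov o z) ≤ 1 - ε) :
    ∫ z, eif P o z ∂P = adjDiff P o := by
  have h := integral_ipw_mul_residual hY o (measurable_propensity P o) hε hpos
  have h1 := (integrable_outcomeReg P hY o hε hpos 1).sub (integrable_outcomeReg P hY o hε hpos 0)
  have := integral_add h1 h.1
  rw [h.2, add_zero] at this
  exact this

/-! ### The second-order bias -/

theorem integrable_of_eLpNorm_two_lt_top {f : Obs d → ℝ} (hf : Measurable f)
    (h : eLpNorm f 2 P < ∞) : Integrable f P :=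
  (MemLp.mono_exponent (p := 1) (q := 2) ⟨hf.aestronglyMeasurable, h⟩ (by norm_num)).integrable
    le_rfl

variable {P} in
/-- The mean of `φ̂ - φ` is at most a multiple of the product of the nuisance errors. -/
theorem enorm_integral_aipw_sub_eif_le (hY : Integrable (out (d := d)) P) (o : Option (Fin d))
    {ε : ℝ} (hε : 0 < ε)
    (hpos : ∀ᵐ z ∂P, ε ≤ propensity P o (cov o z) ∧ propensity P o (cov o z) ≤ 1 - ε)
    {p : Cov d o → ℝ} (hp : Measurable p) {m : Fin 2 → Cov d o → ℝ} (hm : ∀ a, Measurable (m a))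
    {c : ℝ} (hc : 0 < c) (hpc : ∀ᵐ z ∂P, c ≤ p (cov o z) ∧ p (cov o z) ≤ 1 - c)
    (hint : Integrable (fun z => aipw o p m z - eif P o z) P) :
    ‖∫ z, (aipw o p m z - eif P o z) ∂P‖ₑ ≤ ENNReal.ofReal c⁻¹ *
      (eLpNorm (fun z => p (cov o z) - propensity P o (cov o z)) 2 P
        * ∑ a : Fin 2, eLpNorm (fun z => m a (cov o z) - outcomeReg P o a (cov o z)) 2 P) := by
  have hπ := measurable_propensity P o
  have hμ := measurable_outcomeReg P o
  have hcov := measurable_cov (d := d) o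
  have r1 := integral_ipw_mul_residual hY o hp hc hpc
  have r2 := integral_ipw_mul_residual hY o hπ hε hpos
  set δ : Fin 2 → Cov d o → ℝ := fun a x => m a x - outcomeReg P o a x with hδ
  have hδm : ∀ a, Measurable (δ a) := fun a => (hm a).sub (hμ a)
  have hδm' : Measurable fun q : Cov d o × Fin 2 => δ q.2 q.1 :=
    measurable_from_prod_countable_left hδm
  have hval : Measurable fun q : Cov d o × Fin 2 => ((q.2 : ℕ) : ℝ) :=
    (measurable_of_countable fun a : Fin 2 => ((a : ℕ) : ℝ)).comp measurable_snd
  -- What is left of `φ̂ - φ` once the true residuals, under both the estimated and the true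
  -- weights, are removed. It no longer involves `Y`, so only the exposure has to be averaged out.
  let g : Cov d o × Fin 2 → ℝ := fun q =>
    δ 1 q.1 - δ 0 q.1 - (((q.2 : ℕ) : ℝ) / p q.1 - (1 - ((q.2 : ℕ) : ℝ)) / (1 - p q.1)) * δ q.2 q.1
  have hg : Measurable g := by
    have h0 := (hδm 0).comp (measurable_fst : Measurable (Prod.fst : Cov d o × Fin 2 → Cov d o))
    have h1 := (hδm 1).comp (measurable_fst : Measurable (Prod.fst : Cov d o × Fin 2 → Cov d o))
    have hp' := hp.comp (measurable_fst : Measurable (Prod.fst : Cov d o × Fin 2 → Cov d o))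
    exact (h1.sub h0).sub (((hval.div hp').sub
      ((measurable_const.sub hval).div (measurable_const.sub hp'))).mul hδm')
  have hdec : ∀ z, aipw o p m z - eif P o z
      - (ipw o p z * (out z - outcomeReg P o (trt z) (cov o z))
      - ipw o (propensity P o) z * (out z - outcomeReg P o (trt z) (cov o z)))
      = g (cov o z, trt z) := fun z => by
    simp only [eif, aipw_eq, g, hδ, ipw]
    ring
  have hgi : Integrable (fun z => g (cov o z, trt z)) P := by
    simp_rw [← hdec]
    exact hint.sub (r1.1.sub r2.1)
  have h1 : ∫ z, (aipw o p m z - eif P o z) ∂P = ∫ z, g (cov o z, trt z) ∂P := by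
    simp_rw [← hdec]
    have h2 := integral_sub r1.1 r2.1
    rw [r1.2, r2.2, sub_zero] at h2
    exact (sub_zero _).symm.trans ((congrArg _ h2.symm).trans
      (integral_sub hint (r1.1.sub r2.1)).symm)
  rw [h1, integral_cov_trt P o hg hgi]
  refine (enorm_integral_le_lintegral_enorm _).trans ?_
  have hpt : ∀ᵐ z ∂P, ‖(1 - propensity P o (cov o z)) * g (cov o z, 0)
      + propensity P o (cov o z) * g (cov o z, 1)‖ₑ ≤ ENNReal.ofReal c⁻¹ *
        (‖p (cov o z) - propensity P o (cov o z)‖ₑ * ‖δ 0 (cov o z)‖ₑ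
          + ‖p (cov o z) - propensity P o (cov o z)‖ₑ * ‖δ 1 (cov o z)‖ₑ) := by
    filter_upwards [hpc] with z hz
    have e1 : 0 < p (cov o z) := hc.trans_le hz.1
    have e2 : c ≤ 1 - p (cov o z) := by linarith [hz.2]
    have e3 : 0 < 1 - p (cov o z) := hc.trans_le e2
    -- Double robustness: the propensity error factors out of the averaged remainder, and the other
    -- factor is linear in the regression errors.
    have key : (1 - propensity P o (cov o z)) * g (cov o z, 0)
        + propensity P o (cov o z) * g (cov o z, 1)
        = (p (cov o z) - propensity P o (cov o z))
          * ((1 - p (cov o z))⁻¹ * δ 0 (cov o z) + (p (cov o z))⁻¹ * δ 1 (cov o z)) := by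
      simp only [g, Fin.val_zero, Fin.val_one, Nat.cast_zero, Nat.cast_one]
      field_simp
      ring
    have i1 : ‖(1 - p (cov o z))⁻¹‖ₑ ≤ ENNReal.ofReal c⁻¹ := by
      rw [Real.enorm_of_nonneg (by positivity)]
      exact ENNReal.ofReal_le_ofReal (inv_anti₀ hc e2)
    have i2 : ‖(p (cov o z))⁻¹‖ₑ ≤ ENNReal.ofReal c⁻¹ := by
      rw [Real.enorm_of_nonneg (by positivity)]
      exact ENNReal.ofReal_le_ofReal (inv_anti₀ hc hz.1)
    rw [key, enorm_mul, ← mul_add, mul_left_comm, mul_add (ENNReal.ofReal c⁻¹)]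
    gcongr
    refine (enorm_add_le _ _).trans ?_
    rw [enorm_mul, enorm_mul]
    gcongr
  have hold : ∀ a, ∫⁻ z, ‖p (cov o z) - propensity P o (cov o z)‖ₑ * ‖δ a (cov o z)‖ₑ ∂P
      ≤ eLpNorm (fun z => p (cov o z) - propensity P o (cov o z)) 2 P
        * eLpNorm (fun z => δ a (cov o z)) 2 P := fun a => by
    have := eLpNorm_smul_le_mul_eLpNorm (p := 2) (q := 2) (r := 1) (μ := P)
      (f := fun z => δ a (cov o z)) (φ := fun z => p (cov o z) - propensity P o (cov o z))
      ((hδm a).comp hcov).aestronglyMeasurable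
      (Measurable.aestronglyMeasurable (by fun_prop))
    rw [eLpNorm_one_eq_lintegral_enorm] at this
    simpa only [Pi.smul_apply', smul_eq_mul, enorm_mul] using this
  refine (lintegral_mono_ae hpt).trans ?_
  have := hδm 0
  rw [lintegral_const_mul' _ _ ENNReal.ofReal_ne_top, lintegral_add_left (by fun_prop),
    Fin.sum_univ_two, mul_add (eLpNorm _ _ _)]
  gcongr
  · exact hold 0
  · exact hold 1

end Nuisance

end EffectDifferences

namespace EffectDifferences

/-! ### Calculus of `o_ℙ` for nonnegative extended quantities. -/

section LittleO

variable {Ω : Type*} [MeasurableSpace Ω] {μ : Measure Ω}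

theorem IsLittleOProb.mono {R S : ℕ → Ω → ℝ≥0∞} {r : ℕ → ℝ} (hS : IsLittleOProb μ S r)
    (h : ∀ᶠ n in atTop, ∀ᵐ ω ∂μ, R n ω ≤ S n ω) : IsLittleOProb μ R r := fun ε hε => by
  refine tendsto_of_tendsto_of_tendsto_of_le_of_le' tendsto_const_nhds (hS ε hε)
    (Eventually.of_forall fun _ => zero_le) ?_
  filter_upwards [h] with n hn
  refine measure_mono_ae ?_
  filter_upwards [hn] with ω hω h1
  exact lt_of_lt_of_le h1 hω

/-- It is enough to bound `R` outside of events of vanishing probability. -/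
theorem IsLittleOProb.of_tendsto {R S : ℕ → Ω → ℝ≥0∞} {r : ℕ → ℝ} (hS : IsLittleOProb μ S r)
    {B : ℕ → Set Ω} (hB : Tendsto (fun n => μ (B n)) atTop (𝓝 0))
    (h : ∀ᶠ n in atTop, ∀ᵐ ω ∂μ, ω ∉ B n → R n ω ≤ S n ω) : IsLittleOProb μ R r := fun ε hε => by
  have h0 := (hS ε hε).add hB
  rw [add_zero] at h0
  refine tendsto_of_tendsto_of_tendsto_of_le_of_le' tendsto_const_nhds h0
    (Eventually.of_forall fun _ => zero_le) ?_
  filter_upwards [h] with n hn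
  refine (measure_mono_ae ?_).trans (measure_union_le _ _)
  filter_upwards [hn] with ω hω h1
  by_cases hb : ω ∈ B n
  · exact Or.inr hb
  · exact Or.inl (lt_of_lt_of_le h1 (hω hb))

theorem IsLittleOProb.add {R S : ℕ → Ω → ℝ≥0∞} {r : ℕ → ℝ} (hR : IsLittleOProb μ R r)
    (hS : IsLittleOProb μ S r) (hr : ∀ n, 0 ≤ r n) :
    IsLittleOProb μ (fun n ω => R n ω + S n ω) r := fun ε hε => by
  have h0 := (hR (ε / 2) (by positivity)).add (hS (ε / 2) (by positivity))
  rw [add_zero] at h0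
  refine tendsto_of_tendsto_of_tendsto_of_le_of_le tendsto_const_nhds h0
    (fun _ => zero_le) fun n => ?_
  refine (measure_mono fun ω hω => ?_).trans (measure_union_le _ _)
  by_contra hcon
  simp only [Set.mem_union, Set.mem_ofPred_eq, not_or, not_lt] at hcon hω
  have := add_le_add hcon.1 hcon.2
  have hn := hr n
  rw [← ENNReal.ofReal_add (by positivity) (by positivity), ← add_mul, add_halves] at this
  exact absurd hω this.not_gt

theorem IsLittleOProb.const_mul {R : ℕ → Ω → ℝ≥0∞} {r : ℕ → ℝ} (hR : IsLittleOProb μ R r)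
    {C : ℝ} (hC : 0 < C) :
    IsLittleOProb μ (fun n ω => ENNReal.ofReal C * R n ω) r := fun ε hε => by
  refine (hR (ε / C) (by positivity)).congr fun n => ?_
  congr 1
  ext ω
  simp only [Set.mem_ofPred_eq]
  have h1 : ENNReal.ofReal (ε * r n) = ENNReal.ofReal C * ENNReal.ofReal (ε / C * r n) := by
    rw [← ENNReal.ofReal_mul hC.le]
    congr 1
    field_simp
  rw [h1, ENNReal.mul_lt_mul_iff_right (by simpa using hC) ENNReal.ofReal_ne_top]

theorem IsLittleOProb.rate_mono {R : ℕ → Ω → ℝ≥0∞} {r s : ℕ → ℝ} (hR : IsLittleOProb μ R r)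
    (h : ∀ᶠ n in atTop, r n ≤ s n) : IsLittleOProb μ R s := fun ε hε => by
  refine tendsto_of_tendsto_of_tendsto_of_le_of_le' tendsto_const_nhds (hR ε hε)
    (Eventually.of_forall fun _ => zero_le) ?_
  filter_upwards [h] with n hn
  refine measure_mono fun ω hω => ?_
  exact lt_of_le_of_lt (ENNReal.ofReal_le_ofReal (by gcongr)) (show _ < _ from hω)

theorem rpow_neg_half_le_one : ∀ᶠ n : ℕ in atTop, (n : ℝ) ^ (-(1 / 2) : ℝ) ≤ 1 := by
  filter_upwards [eventually_ge_atTop 1] with n hn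
  exact Real.rpow_le_one_of_one_le_of_nonpos (by exact_mod_cast hn) (by norm_num)

end LittleO

/-! ### Sample averages of fixed and of trained functions. -/

section Sampling

variable {d : ℕ} {P : Measure (Obs d)}
  {Ω : Type*} [MeasurableSpace Ω] {Pr : Measure Ω} [IsProbabilityMeasure Pr]
  {Z : ℕ → Ω → Obs d}

theorem empMean_sub (n : ℕ) (z : ℕ → Obs d) (f g : Obs d → ℝ) :
    empMean n z (fun w => f w - g w) = empMean n z f - empMean n z g := by
  simp only [empMean, Finset.sum_sub_distrib, mul_sub]

theorem empMean_add (n : ℕ) (z : ℕ → Obs d) (f g : Obs d → ℝ) :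
    empMean n z (fun w => f w + g w) = empMean n z f + empMean n z g := by
  simp only [empMean, Finset.sum_add_distrib, mul_add]

theorem empMean_const_mul (n : ℕ) (z : ℕ → Obs d) (a : ℝ) (f : Obs d → ℝ) :
    empMean n z (fun w => a * f w) = a * empMean n z f := by
  simp only [empMean, ← Finset.mul_sum]
  ring

/-- The weak law of large numbers for the sample averages of an integrable function. -/
theorem isLittleOProb_empMean_sub_integral (hZmeas : ∀ i, Measurable (Z i))
    (hZlaw : ∀ i, Measure.map (Z i) Pr = P) (hZindep : iIndepFun Z Pr)
    {f : Obs d → ℝ} (hf : Measurable f) (hfi : Integrable f P) :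
    IsLittleOProb Pr (fun n ω => ‖empMean n (fun i => Z i ω) f - ∫ z, f z ∂P‖ₑ) (fun _ => 1) := by
  have hint : Integrable (fun ω => f (Z 0 ω)) Pr := by
    rw [← hZlaw 0] at hfi
    exact (integrable_map_measure hf.aestronglyMeasurable (hZmeas 0).aemeasurable).1 hfi
  have hmean : ∫ ω, f (Z 0 ω) ∂Pr = ∫ z, f z ∂P := by
    rw [← hZlaw 0, integral_map (hZmeas 0).aemeasurable hf.aestronglyMeasurable]
  -- Only a first moment is assumed, so Chebyshev is not available; almost sure convergence is
  -- weakened to convergence in probability.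
  have h := strong_law_ae_real (μ := Pr) (fun i ω => f (Z i ω)) hint
    (fun i j hij => (hZindep.indepFun hij).comp hf hf)
    (fun i => (IdentDistrib.mk (hZmeas i).aemeasurable (hZmeas 0).aemeasurable
      ((hZlaw i).trans (hZlaw 0).symm)).comp hf)
  rw [hmean] at h
  have hm : ∀ n : ℕ, AEStronglyMeasurable (fun ω => empMean n (fun i => Z i ω) f) Pr := fun n => by
    unfold empMean
    exact Measurable.aestronglyMeasurable (by fun_prop)
  have h2 : TendstoInMeasure Pr (fun (n : ℕ) ω => empMean n (fun i => Z i ω) f) atTop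
      (fun _ => ∫ z, f z ∂P) := by
    refine tendstoInMeasure_of_tendsto_ae hm ?_
    filter_upwards [h] with ω hω
    refine hω.congr fun n => ?_
    rw [empMean, div_eq_inv_mul]
  intro ε hε
  refine tendsto_of_tendsto_of_tendsto_of_le_of_le tendsto_const_nhds
    (h2 (ENNReal.ofReal ε) (by simpa using hε)) (fun _ => zero_le) fun n => ?_
  refine measure_mono fun ω hω => ?_
  simp only [Set.mem_ofPred_eq, mul_one] at hω ⊢
  rw [edist_eq_enorm_sub]
  exact hω.le

variable [IsProbabilityMeasure P]

/-- Chebyshev's inequality for the centred sample average of a fixed function. -/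
theorem measure_empMean_sub_integral_le (hZmeas : ∀ i, Measurable (Z i))
    (hZlaw : ∀ i, Measure.map (Z i) Pr = P) (hZindep : iIndepFun Z Pr)
    {f : Obs d → ℝ} (hf : Measurable f) {η ε : ℝ} (hη : 0 < η) (hε : 0 < ε)
    (hfη : eLpNorm f 2 P ≤ ENNReal.ofReal η) {n : ℕ} (hn : 1 ≤ n) :
    Pr {ω | ENNReal.ofReal (ε * (n : ℝ) ^ (-(1 / 2) : ℝ))
        < ‖empMean n (fun i => Z i ω) f - ∫ z, f z ∂P‖ₑ}
      ≤ ENNReal.ofReal (η ^ 2 / ε ^ 2) := by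
  have hn0 : (0 : ℝ) < n := by exact_mod_cast hn
  have hL : MemLp f 2 P := ⟨hf.aestronglyMeasurable, hfη.trans_lt ENNReal.ofReal_lt_top⟩
  have hLi : ∀ i, MemLp (fun ω => f (Z i ω)) 2 Pr := fun i => by
    have h := hL
    rw [← hZlaw i] at h
    exact h.comp_of_map (hZmeas i).aemeasurable
  have hmean : ∀ i, ∫ ω, f (Z i ω) ∂Pr = ∫ z, f z ∂P := fun i => by
    rw [← hZlaw i, integral_map (hZmeas i).aemeasurable hf.aestronglyMeasurable]
  have hvar : ∀ i, Var[fun ω => f (Z i ω); Pr] = Var[f; P] := fun i => by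
    rw [← hZlaw i, variance_map hf.aemeasurable (hZmeas i).aemeasurable]
    rfl
  have hvle : Var[f; P] ≤ η ^ 2 := by
    refine (variance_le_expectation_sq hL.aestronglyMeasurable).trans ?_
    have h1 : eLpNorm f 2 P ^ 2 = ENNReal.ofReal (∫ z, f z ^ 2 ∂P) := by
      have h3 := eLpNorm_nnreal_pow_eq_lintegral (f := f) (μ := P) (p := 2) two_ne_zero
      simp only [NNReal.coe_ofNat, ENNReal.rpow_ofNat, ENNReal.coe_ofNat] at h3
      rw [h3]
      rw [ofReal_integral_eq_lintegral_ofReal hL.integrable_sq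
        (Eventually.of_forall fun z => sq_nonneg _)]
      refine lintegral_congr fun z => ?_
      rw [← Real.enorm_of_nonneg (sq_nonneg _), enorm_pow]
    have h2 : ENNReal.ofReal (∫ z, f z ^ 2 ∂P) ≤ ENNReal.ofReal (η ^ 2) := by
      rw [← h1, ENNReal.ofReal_pow hη.le]
      gcongr
    exact (ENNReal.ofReal_le_ofReal_iff (by positivity)).1 h2
  have hS : MemLp (∑ i ∈ Finset.range n, fun ω => f (Z i ω)) 2 Pr :=
    memLp_finsetSum' _ fun i _ => hLi i
  have hSvar : Var[∑ i ∈ Finset.range n, fun ω => f (Z i ω); Pr] = n * Var[f; P] := by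
    rw [IndepFun.variance_sum (fun i _ => hLi i)
      (fun i _ j _ hij => (hZindep.indepFun hij).comp hf hf)]
    simp [hvar]
  have hSmean : ∫ ω, (∑ i ∈ Finset.range n, fun ω => f (Z i ω)) ω ∂Pr = n * ∫ z, f z ∂P := by
    simp only [Finset.sum_apply]
    rw [integral_finsetSum _ fun i _ => (hLi i).integrable (by norm_num)]
    simp [hmean]
  have hs : (n : ℝ) ^ (-(1 / 2) : ℝ) = (Real.sqrt n)⁻¹ := by
    rw [Real.rpow_neg hn0.le, Real.sqrt_eq_rpow]
  have hsq : Real.sqrt n * Real.sqrt n = n := Real.mul_self_sqrt hn0.le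
  have hspos : 0 < Real.sqrt n := Real.sqrt_pos.2 hn0
  -- Applied to the sum rather than the average: the threshold is `n` times `ε n^(-1/2)`, and the
  -- factor `n` in the variance of the sum then cancels.
  have hch := meas_ge_le_variance_div_sq hS (c := ε * Real.sqrt n) (by positivity)
  rw [hSvar, hSmean] at hch
  refine (measure_mono fun ω hω => ?_).trans (hch.trans (ENNReal.ofReal_le_ofReal ?_))
  · simp only [Set.mem_ofPred_eq, Finset.sum_apply] at hω ⊢
    rw [Real.enorm_eq_ofReal_abs, hs] at hω
    have h3 := (ENNReal.ofReal_lt_ofReal_iff'.1 hω).1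
    have h4 : ∑ i ∈ Finset.range n, f (Z i ω) - n * ∫ z, f z ∂P
        = n * (empMean n (fun i => Z i ω) f - ∫ z, f z ∂P) := by
      rw [empMean]; field_simp
    rw [h4, abs_mul, abs_of_pos hn0]
    have h5 : ε * Real.sqrt n = n * (ε * (Real.sqrt n)⁻¹) := by
      field_simp
      linarith
    rw [h5]
    gcongr
  · rw [mul_pow, Real.sq_sqrt hn0.le]
    have : (n : ℝ) * Var[f; P] / (ε ^ 2 * n) = Var[f; P] / ε ^ 2 := by field_simp
    rw [this]
    gcongr

/-- Conditionally on independent training data, the empirical process at a function that is close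
to zero in `L₂(P)` is small. -/
theorem measure_empMean_training_le (hZmeas : ∀ i, Measurable (Z i))
    (hZlaw : ∀ i, Measure.map (Z i) Pr = P) (hZindep : iIndepFun Z Pr)
    {T : Type*} [MeasurableSpace T] {D : Ω → T} (hDmeas : Measurable D) {n : ℕ} (hn : 1 ≤ n)
    (hDindep : IndepFun D (fun ω (i : Fin n) => Z i ω) Pr)
    {h : T → Obs d → ℝ} (hh : Measurable (Function.uncurry h)) {η ε : ℝ} (hη : 0 < η)
    (hε : 0 < ε) :
    Pr {ω | eLpNorm (h (D ω)) 2 P ≤ ENNReal.ofReal η ∧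
        ENNReal.ofReal (ε * (n : ℝ) ^ (-(1 / 2) : ℝ))
          < ‖empMean n (fun i => Z i ω) (h (D ω)) - ∫ z, h (D ω) z ∂P‖ₑ}
      ≤ ENNReal.ofReal (η ^ 2 / ε ^ 2) := by
  have hV : Measurable fun ω (i : Fin n) => Z i ω := measurable_pi_lambda _ fun i => hZmeas i
  have hmI : Measurable fun t => ∫ z, h t z ∂P :=
    hh.stronglyMeasurable.integral_prod_right.measurable
  have hmN : Measurable fun t => eLpNorm (h t) 2 P := by
    simp_rw [eLpNorm_eq_lintegral_rpow_enorm_toReal (two_ne_zero) ENNReal.ofNat_ne_top]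
    refine Measurable.pow_const (Measurable.lintegral_prod_right' (f := fun q : T × Obs d =>
      ‖h q.1 q.2‖ₑ ^ (2 : ℝ≥0∞).toReal) ?_) _
    exact (hh.enorm).pow_const _
  -- By independence the law of training data and sample is a product, so the probability of this
  -- event is an average over `t` of the probabilities of its slices.
  let S : Set (T × (Fin n → Obs d)) := {q | eLpNorm (h q.1) 2 P ≤ ENNReal.ofReal η ∧
    ENNReal.ofReal (ε * (n : ℝ) ^ (-(1 / 2) : ℝ))
      < ‖(n : ℝ)⁻¹ * ∑ i, h q.1 (q.2 i) - ∫ z, h q.1 z ∂P‖ₑ}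
  have hSm : MeasurableSet S := by
    refine MeasurableSet.inter (measurableSet_le (hmN.comp measurable_fst) measurable_const)
      (measurableSet_lt measurable_const (Measurable.enorm (Measurable.sub
        (Measurable.const_mul (Finset.measurable_sum _ fun i _ => ?_) _)
        (hmI.comp measurable_fst))))
    exact hh.comp (measurable_fst.prodMk ((measurable_pi_apply i).comp measurable_snd))
  have hpre : {ω | eLpNorm (h (D ω)) 2 P ≤ ENNReal.ofReal η ∧
      ENNReal.ofReal (ε * (n : ℝ) ^ (-(1 / 2) : ℝ))
        < ‖empMean n (fun i => Z i ω) (h (D ω)) - ∫ z, h (D ω) z ∂P‖ₑ}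
      = (fun ω => (D ω, fun i : Fin n => Z i ω)) ⁻¹' S := by
    ext ω
    simp only [S, Set.mem_ofPred_eq, Set.preimage_ofPred_eq, empMean,
      Finset.sum_range fun i => h (D ω) (Z i ω)]
  have : IsProbabilityMeasure (Pr.map D) := Measure.isProbabilityMeasure_map hDmeas.aemeasurable
  rw [hpre, ← Measure.map_apply (hDmeas.prodMk hV) hSm,
    (indepFun_iff_map_prod_eq_prod_map_map hDmeas.aemeasurable hV.aemeasurable).1 hDindep,
    Measure.prod_apply hSm]
  refine (lintegral_mono (g := fun _ => ENNReal.ofReal (η ^ 2 / ε ^ 2)) fun t => ?_).trans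
    (by simp)
  have hht : Measurable (h t) := hh.comp measurable_prodMk_left
  rw [Measure.map_apply hV (measurable_prodMk_left hSm)]
  by_cases ht : eLpNorm (h t) 2 P ≤ ENNReal.ofReal η
  · refine (measure_mono fun ω hω => ?_).trans
      (measure_empMean_sub_integral_le hZmeas hZlaw hZindep hht hη hε ht hn)
    have := hω.2
    simp only [Set.mem_ofPred_eq, empMean, Finset.sum_range fun i => h t (Z i ω)]
    exact this
  -- The norm condition is part of the event, so the slice at such a `t` is empty.
  · refine (measure_mono_null (fun ω hω => ht hω.1) measure_empty).le.trans zero_le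

/-- Either the trained function has `L₂` norm above a small level, which is unlikely by consistency,
or the conditional Chebyshev bound applies. -/
theorem isLittleOProb_empMean_training (hZmeas : ∀ i, Measurable (Z i))
    (hZlaw : ∀ i, Measure.map (Z i) Pr = P) (hZindep : iIndepFun Z Pr)
    {T : ℕ → Type*} [∀ n, MeasurableSpace (T n)] {D : (n : ℕ) → Ω → T n}
    (hDmeas : ∀ n, Measurable (D n))
    (hDindep : ∀ n, IndepFun (D n) (fun ω (i : Fin n) => Z i ω) Pr)
    {h : (n : ℕ) → T n → Obs d → ℝ} (hh : ∀ n, Measurable (Function.uncurry (h n)))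
    (hcons : IsLittleOProb Pr (fun n ω => eLpNorm (h n (D n ω)) 2 P) (fun _ => 1)) :
    IsLittleOProb Pr
      (fun n ω => ‖empMean n (fun i => Z i ω) (h n (D n ω)) - ∫ z, h n (D n ω) z ∂P‖ₑ)
      (fun n => (n : ℝ) ^ (-(1 / 2) : ℝ)) := fun ε hε => by
  rw [ENNReal.tendsto_nhds_zero]
  intro κ hκ
  -- The Chebyshev bound is free of `n`, so the level `η` can be fixed before `n` grows.
  obtain ⟨η, hη, hηκ⟩ : ∃ η : ℝ, 0 < η ∧ ENNReal.ofReal (η ^ 2 / ε ^ 2) ≤ κ / 2 := by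
    have hc : Tendsto (fun η : ℝ => ENNReal.ofReal (η ^ 2 / ε ^ 2)) (𝓝[>] 0) (𝓝 0) := by
      have : Continuous fun η : ℝ => ENNReal.ofReal (η ^ 2 / ε ^ 2) :=
        ENNReal.continuous_ofReal.comp (by fun_prop)
      have h0 := this.tendsto 0
      simp only [ne_eq, OfNat.ofNat_ne_zero, not_false_eq_true, zero_pow, zero_div,
        ENNReal.ofReal_zero] at h0
      exact h0.mono_left nhdsWithin_le_nhds
    have h1 := (ENNReal.tendsto_nhds_zero.1 hc (κ / 2) (ENNReal.half_pos hκ.ne')).and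
      self_mem_nhdsWithin
    obtain ⟨η, h2, h3⟩ := h1.exists
    exact ⟨η, h3, h2⟩
  filter_upwards [ENNReal.tendsto_nhds_zero.1 (hcons η hη) (κ / 2) (ENNReal.half_pos hκ.ne'),
    eventually_ge_atTop 1] with n h1 hn
  have h2 := (measure_empMean_training_le hZmeas hZlaw hZindep (hDmeas n) hn (hDindep n) (hh n)
    hη hε).trans hηκ
  rw [← ENNReal.add_halves κ]
  refine (measure_mono fun ω hω => ?_).trans ((measure_union_le _ _).trans (add_le_add h1 h2))
  by_cases hc : eLpNorm (h n (D n ω)) 2 P ≤ ENNReal.ofReal η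
  · exact Or.inr ⟨hc, hω⟩
  · refine Or.inl ?_
    simpa using hc

end Sampling

end EffectDifferences

/-! ### Local linearity of the maximum of absolute values. -/

namespace EffectDifferences

/-- Near a point whose largest coordinate in absolute value is unique and nonzero, the maximum of
the absolute values is an affine function. -/
theorem exists_iSup_abs_sub_eq {ι : Type*} [Finite ι] {a : ι → ℝ} {i₀ : ι} (h0 : a i₀ ≠ 0)
    (hsep : ∀ i, i ≠ i₀ → |a i| < |a i₀|) :
    ∃ η : ℝ, 0 < η ∧ ∀ b : ι → ℝ, (∀ i, |b i - a i| ≤ η) →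
      (⨆ i, |b i|) - ⨆ i, |a i| = Real.sign (a i₀) * (b i₀ - a i₀) := by
  have key : ∀ b : ι → ℝ, (∀ i, i ≠ i₀ → |b i| ≤ |b i₀|) → ⨆ i, |b i| = |b i₀| := fun b hb => by
    have : Nonempty ι := ⟨i₀⟩
    refine le_antisymm (ciSup_le fun i => ?_)
      (le_ciSup (f := fun i => |b i|) (Set.finite_range _).bddAbove i₀)
    by_cases hi : i = i₀
    · rw [hi]
    · exact hb i hi
  -- `η < |a i₀|` keeps the sign of the leading coordinate; a gap above `2 * η` keeps it leading,
  -- since the two absolute values each move by at most `η`.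
  have hη : ∀ᶠ η : ℝ in 𝓝[>] 0, η < |a i₀| ∧ ∀ i, i ≠ i₀ → 2 * η < |a i₀| - |a i| := by
    refine Eventually.and ?_ (eventually_all.2 fun i => ?_)
    · exact nhdsWithin_le_nhds (gt_mem_nhds (abs_pos.2 h0))
    · by_cases hi : i = i₀
      · exact Eventually.of_forall fun _ h => absurd hi h
      · have h1 := gt_mem_nhds (half_pos (sub_pos.2 (hsep i hi)))
        filter_upwards [nhdsWithin_le_nhds h1] with η h2 _
        linarith
  obtain ⟨η, ⟨h1, h2⟩, h3⟩ := (hη.and self_mem_nhdsWithin).exists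
  refine ⟨η, h3, fun b hb => ?_⟩
  have hb0 := abs_le.1 (hb i₀)
  rw [key a fun i hi => (hsep i hi).le, key b fun i hi => ?_]
  · rcases lt_or_gt_of_ne h0 with h | h
    · rw [abs_of_neg h] at h1 ⊢
      rw [Real.sign_of_neg h, abs_of_neg (by linarith)]
      ring
    · rw [abs_of_pos h] at h1 ⊢
      rw [Real.sign_of_pos h, abs_of_pos (by linarith)]
      ring
  · have h4 := h2 i hi
    have h5 := abs_sub_abs_le_abs_sub (b i) (a i)
    have h6 := abs_sub_abs_le_abs_sub (a i₀) (b i₀)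
    rw [abs_sub_comm] at h6
    linarith [hb i, hb i₀]

theorem abs_sign_le_one (x : ℝ) : |Real.sign x| ≤ 1 := by
  rcases Real.sign_apply_eq x with h | h | h <;> simp [h]

/-! ### Asymptotic linearity and consistency of the doubly robust estimator. -/

section Estimation

variable {d : ℕ} {P : Measure (Obs d)} [IsProbabilityMeasure P]
  {Ω : Type*} [MeasurableSpace Ω] {Pr : Measure Ω} [IsProbabilityMeasure Pr]
  {Z : ℕ → Ω → Obs d} {T : ℕ → Type*} [∀ n, MeasurableSpace (T n)] {D : (n : ℕ) → Ω → T n}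
  {o : Option (Fin d)} {p : (n : ℕ) → T n → Cov d o → ℝ}
  {m : (n : ℕ) → T n → Fin 2 → Cov d o → ℝ}

theorem measurable_aipw_sub_eif (hp : ∀ n, Measurable fun q : T n × Cov d o => p n q.1 q.2)
    (hm : ∀ n a, Measurable fun q : T n × Cov d o => m n q.1 a q.2) (n : ℕ) :
    Measurable (Function.uncurry fun (t : T n) z => aipw o (p n t) (m n t) z - eif P o z) :=
  (measurable_aipw o (hp n) (hm n)).sub ((measurable_eif P o).comp measurable_snd)

/-- The empirical process at `φ̂ - φ` is negligible. -/
theorem isLittleOProb_empMean_aipw_sub_eif_sub_integral (hZmeas : ∀ i, Measurable (Z i))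
    (hZlaw : ∀ i, Measure.map (Z i) Pr = P) (hZindep : iIndepFun Z Pr)
    (hDmeas : ∀ n, Measurable (D n))
    (hDindep : ∀ n, IndepFun (D n) (fun ω (i : Fin n) => Z i ω) Pr)
    (hp : ∀ n, Measurable fun q : T n × Cov d o => p n q.1 q.2)
    (hm : ∀ n a, Measurable fun q : T n × Cov d o => m n q.1 a q.2)
    (hcons : IsLittleOProb Pr (fun n ω =>
      eLpNorm (fun z => aipw o (p n (D n ω)) (m n (D n ω)) z - eif P o z) 2 P) (fun _ => 1)) :
    IsLittleOProb Pr (fun n ω =>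
      ‖empMean n (fun i => Z i ω) (fun z => aipw o (p n (D n ω)) (m n (D n ω)) z - eif P o z)
        - ∫ z, (aipw o (p n (D n ω)) (m n (D n ω)) z - eif P o z) ∂P‖ₑ)
      (fun n => (n : ℝ) ^ (-(1 / 2) : ℝ)) :=
  isLittleOProb_empMean_training hZmeas hZlaw hZindep hDmeas hDindep
    (h := fun n t z => aipw o (p n t) (m n t) z - eif P o z)
    (measurable_aipw_sub_eif hp hm) hcons

/-- Asymptotic linearity of the doubly robust estimator under the product rate. -/
theorem isLittleOProb_empMean_aipw_sub_empMean_eif (hY : Integrable (out (d := d)) P)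
    (hZmeas : ∀ i, Measurable (Z i))
    (hZlaw : ∀ i, Measure.map (Z i) Pr = P) (hZindep : iIndepFun Z Pr)
    (hDmeas : ∀ n, Measurable (D n))
    (hDindep : ∀ n, IndepFun (D n) (fun ω (i : Fin n) => Z i ω) Pr)
    (hp : ∀ n, Measurable fun q : T n × Cov d o => p n q.1 q.2)
    (hm : ∀ n a, Measurable fun q : T n × Cov d o => m n q.1 a q.2)
    {ε : ℝ} (hε : 0 < ε)
    (hpos : ∀ᵐ z ∂P, ε ≤ propensity P o (cov o z) ∧ propensity P o (cov o z) ≤ 1 - ε)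
    {c : ℝ} (hc : 0 < c)
    (hbdd : ∀ᶠ n in atTop, ∀ᵐ ω ∂Pr, ∀ᵐ z ∂P,
      c ≤ p n (D n ω) (cov o z) ∧ p n (D n ω) (cov o z) ≤ 1 - c)
    (hcons : IsLittleOProb Pr (fun n ω =>
      eLpNorm (fun z => aipw o (p n (D n ω)) (m n (D n ω)) z - eif P o z) 2 P) (fun _ => 1))
    (hrate : IsLittleOProb Pr
      (fun n ω =>
        eLpNorm (fun z => p n (D n ω) (cov o z) - propensity P o (cov o z)) 2 P
          * ∑ a : Fin 2,
              eLpNorm (fun z => m n (D n ω) a (cov o z) - outcomeReg P o a (cov o z)) 2 P)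
      (fun n => (n : ℝ) ^ (-(1 / 2) : ℝ))) :
    IsLittleOProb Pr (fun n ω =>
      ‖empMean n (fun i => Z i ω) (aipw o (p n (D n ω)) (m n (D n ω)))
        - empMean n (fun i => Z i ω) (eif P o)‖ₑ)
      (fun n => (n : ℝ) ^ (-(1 / 2) : ℝ)) := by
  have h1 := isLittleOProb_empMean_aipw_sub_eif_sub_integral hZmeas hZlaw hZindep hDmeas hDindep
    hp hm hcons
  have h2 := h1.add (hrate.const_mul (inv_pos.2 hc)) fun n => by positivity
  -- The level 1 is arbitrary: off this event the `L₂` error is finite, so `φ̂ - φ` is integrable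
  -- and the bias bound applies.
  refine h2.of_tendsto (hcons 1 one_pos) ?_
  filter_upwards [hbdd] with n hn
  filter_upwards [hn] with ω hω hB
  have hlt : eLpNorm (fun z => aipw o (p n (D n ω)) (m n (D n ω)) z - eif P o z) 2 P < ∞ :=
    (not_lt.1 hB).trans_lt ENNReal.ofReal_lt_top
  have hint := integrable_of_eLpNorm_two_lt_top P
    ((measurable_aipw_sub_eif hp hm n).comp (measurable_prodMk_left (x := D n ω))) hlt
  have hbias := enorm_integral_aipw_sub_eif_le hY o hε hpos
    ((hp n).comp (measurable_prodMk_left (x := D n ω)))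
    (fun a => (hm n a).comp (measurable_prodMk_left (x := D n ω))) hc hω hint
  rw [← empMean_sub]
  refine le_trans ?_ (add_le_add_right hbias _)
  refine le_trans (le_of_eq ?_) (enorm_add_le _ _)
  congr 1
  exact (sub_add_cancel _ _).symm

/-- Consistency of the doubly robust estimator. -/
theorem isLittleOProb_empMean_aipw_sub_adjDiff (hY : Integrable (out (d := d)) P)
    (hZmeas : ∀ i, Measurable (Z i))
    (hZlaw : ∀ i, Measure.map (Z i) Pr = P) (hZindep : iIndepFun Z Pr)
    (hDmeas : ∀ n, Measurable (D n))
    (hDindep : ∀ n, IndepFun (D n) (fun ω (i : Fin n) => Z i ω) Pr)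
    (hp : ∀ n, Measurable fun q : T n × Cov d o => p n q.1 q.2)
    (hm : ∀ n a, Measurable fun q : T n × Cov d o => m n q.1 a q.2)
    {ε : ℝ} (hε : 0 < ε)
    (hpos : ∀ᵐ z ∂P, ε ≤ propensity P o (cov o z) ∧ propensity P o (cov o z) ≤ 1 - ε)
    (hcons : IsLittleOProb Pr (fun n ω =>
      eLpNorm (fun z => aipw o (p n (D n ω)) (m n (D n ω)) z - eif P o z) 2 P) (fun _ => 1)) :
    IsLittleOProb Pr (fun n ω =>
      ‖empMean n (fun i => Z i ω) (aipw o (p n (D n ω)) (m n (D n ω))) - adjDiff P o‖ₑ)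
      (fun _ => 1) := by
  have h1 := (isLittleOProb_empMean_aipw_sub_eif_sub_integral hZmeas hZlaw hZindep hDmeas hDindep
    hp hm hcons).rate_mono rpow_neg_half_le_one
  have h2 := isLittleOProb_empMean_sub_integral hZmeas hZlaw hZindep (measurable_eif P o)
    (integrable_eif hY o hε hpos)
  rw [integral_eif hY o hε hpos] at h2
  refine ((h1.add hcons fun _ => zero_le_one).add h2 fun _ => zero_le_one).mono
    (Eventually.of_forall fun n => Eventually.of_forall fun ω => ?_)
  set z := fun i => Z i ω
  set φ := aipw o (p n (D n ω)) (m n (D n ω))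
  have hφ : Measurable fun z => φ z - eif P o z :=
    (measurable_aipw_sub_eif hp hm n).comp (measurable_prodMk_left (x := D n ω))
  -- Without a product rate, the bias is controlled by the `L₂` error alone. No integrability is
  -- needed: the bound is trivial when the integral takes its default value zero.
  have hI : ‖∫ z, (φ z - eif P o z) ∂P‖ₑ ≤ eLpNorm (fun z => φ z - eif P o z) 2 P := by
    refine (enorm_integral_le_lintegral_enorm _).trans ?_
    rw [← eLpNorm_one_eq_lintegral_enorm]
    exact eLpNorm_le_eLpNorm_of_exponent_le (by norm_num) hφ.aestronglyMeasurable
  have hdec : empMean n z φ - adjDiff P o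
      = ((empMean n z (fun z => φ z - eif P o z) - ∫ z, (φ z - eif P o z) ∂P)
        + ∫ z, (φ z - eif P o z) ∂P) + (empMean n z (eif P o) - adjDiff P o) := by
    rw [empMean_sub]
    ring
  rw [hdec]
  refine (enorm_add_le _ _).trans (add_le_add_left ((enorm_add_le _ _).trans ?_) _)
  exact add_le_add_right hI _

end Estimation

end EffectDifferences

/-! ### Asymptotic linearity of the estimated upper bound. -/

theorem mainTheorem1 {d : ℕ}
    -- the law of one observation `Z = (X, A, Y)`, with integrable outcome
    (P : Measure (Obs d)) [IsProbabilityMeasure P]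
    (hY : Integrable (out (d := d)) P)
    -- the estimation sample: independent observations with law `P`
    {Ω : Type*} [MeasurableSpace Ω] (Pr : Measure Ω) [IsProbabilityMeasure Pr]
    (Z : ℕ → Ω → Obs d) (hZmeas : ∀ i, Measurable (Z i))
    (hZlaw : ∀ i, Measure.map (Z i) Pr = P) (hZindep : iIndepFun Z Pr)
    -- the training data used at sample size `n` (for instance `n` further observations),
    -- independent of the estimation sample
    {T : ℕ → Type*} [∀ n, MeasurableSpace (T n)] (D : (n : ℕ) → Ω → T n)
    (hDmeas : ∀ n, Measurable (D n))
    (hDindep : ∀ n, IndepFun (D n) (fun ω (i : Fin n) => Z i ω) Pr)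
    -- the estimated nuisance functions, computed from the training data
    (piHat : (n : ℕ) → (o : Option (Fin d)) → T n → Cov d o → ℝ)
    (muHat : (n : ℕ) → (o : Option (Fin d)) → T n → Fin 2 → Cov d o → ℝ)
    (hpimeas : ∀ n o, Measurable (fun q : T n × Cov d o => piHat n o q.1 q.2))
    (hmumeas : ∀ n o a, Measurable (fun q : T n × Cov d o => muHat n o q.1 a q.2))
    (Γ : ℝ) (hΓ : 0 < Γ)
    -- positivity
    (hpos : ∃ ε : ℝ, 0 < ε ∧ ∀ᵐ z ∂P,
      ε ≤ propensity P none (cov none z) ∧ propensity P none (cov none z) ≤ 1 - ε)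
    -- nonzero measured confounding
    (hnonzero : ∃ j : Fin d, 0 < |adjDiff P none - adjDiff P (some j)|)
    -- separation of the maximum, attained at `j'` only
    (j' : Fin d)
    (hsep : ∀ j : Fin d, j ≠ j' →
      |adjDiff P none - adjDiff P (some j)| < |adjDiff P none - adjDiff P (some j')|)
    -- estimated propensity scores bounded away from zero and one
    (hbdd : ∃ c : ℝ, 0 < c ∧ ∀ o : Option (Fin d), ∀ᶠ n in atTop, ∀ᵐ ω ∂Pr, ∀ᵐ z ∂P,
      c ≤ piHat n o (D n ω) (cov o z) ∧ piHat n o (D n ω) (cov o z) ≤ 1 - c)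
    -- consistency of the estimated influence functions in `L₂(P)`
    (hcons : ∀ o : Option (Fin d), IsLittleOProb Pr
      (fun n ω => eLpNorm
        (fun z => aipw o (piHat n o (D n ω)) (muHat n o (D n ω)) z - eif P o z) 2 P)
      (fun _ => 1))
    -- product rate, for the full covariate set and for the set without covariate `j'` only
    (hrate : ∀ o : Option (Fin d), o = none ∨ o = some j' → IsLittleOProb Pr
      (fun n ω =>
        eLpNorm (fun z => piHat n o (D n ω) (cov o z) - propensity P o (cov o z)) 2 P
          * ∑ a : Fin 2,
              eLpNorm (fun z => muHat n o (D n ω) a (cov o z) - outcomeReg P o a (cov o z)) 2 P)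
      (fun n => (n : ℝ) ^ (-(1 / 2) : ℝ))) :
    -- the influence function of the estimated upper bound
    let infl : Obs d → ℝ := fun z =>
      eif P none z
        + Real.sign (adjDiff P none - adjDiff P (some j')) * Γ * (eif P none z - eif P (some j') z)
    Integrable infl P ∧
      IsLittleOProb Pr
        (fun n ω =>
          ‖(upperEst Γ n (fun i => Z i ω)
                (fun o => aipw o (piHat n o (D n ω)) (muHat n o (D n ω)))
              - upperBound P Γ)
            - (empMean n (fun i => Z i ω) infl - ∫ z, infl z ∂P)‖ₑ)
        (fun n => (n : ℝ) ^ (-(1 / 2) : ℝ)) := by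
  obtain ⟨ε, hε, hpos⟩ := hpos
  obtain ⟨c, hc, hbdd⟩ := hbdd
  have hposo := propensity_bounds_of_none P hpos
  intro infl
  set s := Real.sign (adjDiff P none - adjDiff P (some j')) with hs
  have hφi : ∀ o, Integrable (eif P o) P := fun o => integrable_eif hY o hε (hposo o)
  have hφm : ∀ o, ∫ z, eif P o z ∂P = adjDiff P o := fun o => integral_eif hY o hε (hposo o)
  have hdi : Integrable (fun z => s * Γ * (eif P none z - eif P (some j') z)) P :=
    ((hφi none).sub (hφi (some j'))).const_mul _
  have hinfl : Integrable infl P := (hφi none).add hdi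
  refine ⟨hinfl, ?_⟩
  have hinflm : ∫ z, infl z ∂P
      = adjDiff P none + s * Γ * (adjDiff P none - adjDiff P (some j')) := by
    rw [integral_add (hφi none) hdi, integral_const_mul,
      integral_sub (hφi none) (hφi (some j')), hφm, hφm]
  have hlin : ∀ o, o = none ∨ o = some j' → IsLittleOProb Pr (fun n ω =>
      ‖empMean n (fun i => Z i ω) (aipw o (piHat n o (D n ω)) (muHat n o (D n ω)))
        - empMean n (fun i => Z i ω) (eif P o)‖ₑ) (fun n => (n : ℝ) ^ (-(1 / 2) : ℝ)) :=
    fun o ho => isLittleOProb_empMean_aipw_sub_empMean_eif (p := fun n => piHat n o)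
      (m := fun n => muHat n o) hY hZmeas hZlaw hZindep hDmeas hDindep (fun n => hpimeas n o)
      (fun n => hmumeas n o) hε (hposo o) hc (hbdd o) (hcons o) (hrate o ho)
  have hconsist : ∀ o, IsLittleOProb Pr (fun n ω =>
      ‖empMean n (fun i => Z i ω) (aipw o (piHat n o (D n ω)) (muHat n o (D n ω)))
        - adjDiff P o‖ₑ) (fun _ => 1) :=
    fun o => isLittleOProb_empMean_aipw_sub_adjDiff (p := fun n => piHat n o)
      (m := fun n => muHat n o) hY hZmeas hZlaw hZindep hDmeas hDindep (fun n => hpimeas n o)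
      (fun n => hmumeas n o) hε (hposo o) (hcons o)
  -- Some difference is nonzero and the one at `j'` is the largest, so its sign is well determined.
  have hne : adjDiff P none - adjDiff P (some j') ≠ 0 := by
    obtain ⟨j, hj⟩ := hnonzero
    by_cases hjj : j = j'
    · rw [← hjj]
      exact abs_pos.1 hj
    · exact abs_pos.1 (hj.trans (hsep j hjj))
  obtain ⟨η, hη, hmax⟩ := exists_iSup_abs_sub_eq
    (a := fun j : Fin d => adjDiff P none - adjDiff P (some j)) hne hsep
  -- Each coordinate of the maximum is a difference of two estimators, so errors of `η / 2` each
  -- keep it within `η`.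
  have hB : Tendsto (fun n => Pr (⋃ o, {ω | ENNReal.ofReal (η / 2 * 1)
      < ‖empMean n (fun i => Z i ω) (aipw o (piHat n o (D n ω)) (muHat n o (D n ω)))
        - adjDiff P o‖ₑ})) atTop (𝓝 0) := by
    have h1 := tendsto_finsetSum Finset.univ fun o (_ : o ∈ Finset.univ) =>
      hconsist o (η / 2) (by positivity)
    rw [Finset.sum_const_zero] at h1
    exact tendsto_of_tendsto_of_tendsto_of_le_of_le tendsto_const_nhds h1
      (fun _ => zero_le) fun n => measure_iUnion_fintype_le _ _
  -- The constants dominate the coefficients `1 + s * Γ` and `-(s * Γ)` of the final decomposition,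
  -- as `|s| ≤ 1`.
  have hsum := ((hlin none (Or.inl rfl)).const_mul (by positivity : 0 < 1 + Γ)).add
    ((hlin (some j') (Or.inr rfl)).const_mul hΓ) fun n => by positivity
  refine hsum.of_tendsto hB (Eventually.of_forall fun n => Eventually.of_forall fun ω hω => ?_)
  set z := fun i => Z i ω
  set φ : Option (Fin d) → Obs d → ℝ :=
    fun o => aipw o (piHat n o (D n ω)) (muHat n o (D n ω)) with hφ
  have hclose : ∀ o, |empMean n z (φ o) - adjDiff P o| ≤ η / 2 := fun o => by
    have h2 : ‖empMean n z (φ o) - adjDiff P o‖ₑ ≤ ENNReal.ofReal (η / 2 * 1) :=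
      not_lt.1 fun h => hω (Set.mem_iUnion.2 ⟨o, h⟩)
    rw [Real.enorm_eq_ofReal_abs, mul_one] at h2
    exact (ENNReal.ofReal_le_ofReal_iff (by positivity)).1 h2
  have hm := hmax (fun j => empMean n z (fun w => φ none w - φ (some j) w)) fun j => by
    have h1 := abs_le.1 (hclose none)
    have h2 := abs_le.1 (hclose (some j))
    simp only [empMean_sub]
    exact abs_le.2 ⟨by linarith, by linarith⟩
  have hs1 := abs_sign_le_one (adjDiff P none - adjDiff P (some j'))
  have hinfle : empMean n z infl = empMean n z (eif P none)
      + s * Γ * (empMean n z (eif P none) - empMean n z (eif P (some j'))) := by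
    rw [empMean_add, empMean_const_mul, empMean_sub]
  -- By `hm` both maxima are replaced by the signed `j'` coordinate; the population means then
  -- cancel, leaving only differences `ℙₙ φ̂ - ℙₙ φ`.
  have hdec : (upperEst Γ n z φ - upperBound P Γ) - (empMean n z infl - ∫ z, infl z ∂P)
      = (1 + s * Γ) * (empMean n z (φ none) - empMean n z (eif P none))
        + -(s * Γ) * (empMean n z (φ (some j')) - empMean n z (eif P (some j'))) := by
    rw [hinfle, hinflm, upperEst, upperBound]
    rw [← hs, empMean_sub] at hm
    linear_combination Γ * hm
  have hsΓ : |s * Γ| ≤ Γ := by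
    rw [abs_mul, abs_of_pos hΓ]
    exact mul_le_of_le_one_left hΓ.le hs1
  rw [hdec]
  refine (enorm_add_le _ _).trans ?_
  rw [enorm_mul, enorm_mul]
  refine add_le_add (mul_le_mul_left ?_ _) (mul_le_mul_left ?_ _)
  · rw [Real.enorm_eq_ofReal_abs]
    refine ENNReal.ofReal_le_ofReal ((abs_add_le _ _).trans ?_)
    rw [abs_one]
    linarith
  · rw [Real.enorm_eq_ofReal_abs, abs_neg]
    exact ENNReal.ofReal_le_ofReal hsΓ
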